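/- Let $\alpha\in\mathbb R$ and let $p_n\in[0,1]$ satisfy $p_n=\frac12-n^{\alpha}(2/3)^n$ for all sufficiently large $n$. For each $n$ let $\mathbb T_n$ be the rooted ternary tree of depth $n$, with $3^n$ leaves, and let $f_n:\{0,1\}^{3^n}\to\{0,1\}$ be the iterated 3-majority function: given the states ($0$ or $1$) of the leaves, the state of every other vertex is defined recursively as the majority of the states of its three children, and $f_n$ is the state of the root. Let the leaf states $X^{(n)}(t)=(X^{(n)}_l(t))_l$, $t\ge 0$, evolve as independent continuous-time Markov chains on $\{0,1\}$ (with right-continuous paths) that jump from $0$ to $1$ with rate $p_n$ and from $1$ to $0$ with rate $1-p_n$, started from their stationary law (mass $p_n$ at $1$ and $1-p_n$ at $0$). Let $C_n$ be the number of times that $f_n(X^{(n)}(t))$ changes its state during $t\in[0,1]$, and put $\alpha_0=\log(3/2)/\log 2$. 1. If $\alpha>\alpha_0$, then $(f_n)$ is lame with respect to $(p_n)$: $\lim_{n\to\infty}\mathbb P(C_n=0)=1$. 2. If $\alpha<\alpha_0$, then $(f_n)$ is volatile with respect to $(p_n)$: $C_n\to\infty$ in distribution, i.e. $\lim_{n\to\infty}\mathbb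 P(C_n\le M)=0$ for every $M\in\mathbb N$. -/

import Mathlib

open MeasureTheory ProbabilityTheory Filter Topology
open scoped NNReal ENNReal

/-- The law on `{0,1}` (`false` is `0`, `true` is `1`) giving mass `p` to `1` and `1 - p` to `0`. -/
noncomputable def bitWeight (p : unitInterval) : Bool → ℝ
  | true => p
  | false => 1 - p

/-- The rate matrix (generator) of the Markov chain on `{0,1}` that jumps from `0` to `1` with rate
`p` and from `1` to `0` with rate `1 - p`. -/
noncomputable def bitGenerator (p : unitInterval) : Matrix Bool Bool ℝ
  | false, false => -p
  | false, true => p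
  | true, false => 1 - p
  | true, true => -(1 - p)

/-- `X` is a (version with almost surely right-continuous paths of the) continuous time Markov
chain on `{0,1}` with rate matrix `bitGenerator p`, started in stationarity: for all times
`t 0 ≤ t 1 ≤ ⋯ ≤ t k` the law of `(X (t 0), …, X (t k))` is given by the stationary law at `t 0`
and the transition matrices `exp ((t (j+1) - t j) Q)`, where `Q` is the rate matrix. -/
structure IsStationaryBitChain {Ω : Type*} [MeasurableSpace Ω] (p : unitInterval)
    (X : ℝ≥0 → Ω → Bool) (P : Measure Ω) : Prop where
  measurable : ∀ t, Measurable (X t)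
  finiteDimLaw : ∀ (k : ℕ) (t : Fin (k + 1) → ℝ≥0) (x : Fin (k + 1) → Bool), Monotone t →
    P {ω | ∀ j, X (t j) ω = x j} =
      ENNReal.ofReal (bitWeight p (x 0) *
        ∏ j : Fin k, NormedSpace.exp (((t j.succ : ℝ) - (t j.castSucc : ℝ)) • bitGenerator p)
          (x j.castSucc) (x j.succ))
  rightContinuous : ∀ᵐ ω ∂P, ∀ t, ContinuousWithinAt (fun s => X s ω) (Set.Ici t) t

/-- Dynamical bits: independent stationary Markov chains `X i`, all with parameter `p`. -/
structure IsBitDynamics {ι Ω : Type*} [MeasurableSpace Ω] (p : unitInterval)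
    (X : ι → ℝ≥0 → Ω → Bool) (P : Measure Ω) : Prop where
  chain : ∀ i, IsStationaryBitChain p (X i) P
  indep : iIndepFun (fun i ω t => X i t ω) P

/-- The number of times at which a path `g : [0,∞) → {0,1}` changes its state during `[a,b]`
(possibly infinite). -/
noncomputable def numChanges (g : ℝ≥0 → Bool) (a b : ℝ≥0) : ℕ∞ :=
  {t ∈ Set.Icc a b | ¬ ContinuousAt g t}.encard

/-- The number `C` of state changes of `f (X t)` for `t` in `[0,1]`. -/
noncomputable def stateChanges {ι Ω : Type*} (f : (ι → Bool) → Bool) (X : ι → ℝ≥0 → Ω → Bool)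
    (ω : Ω) : ℕ∞ :=
  numChanges (fun t => f (fun i => X i t ω)) 0 1

/-- Lameness of the sequence `f n` under the dynamics `X n`: `ℙ(C n = 0) → 1`. -/
def IsLame {ι Ω : ℕ → Type*} [∀ n, MeasurableSpace (Ω n)] (f : ∀ n, (ι n → Bool) → Bool)
    (X : ∀ n, ι n → ℝ≥0 → Ω n → Bool) (P : ∀ n, Measure (Ω n)) : Prop :=
  Tendsto (fun n => P n {ω | stateChanges (f n) (X n) ω = 0}) atTop (𝓝 1)

/-- Volatility of the sequence `f n` under the dynamics `X n`: `C n → ∞` in distribution, that is,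
`ℙ(C n ≤ M) → 0` for every `M`. -/
def IsVolatile {ι Ω : ℕ → Type*} [∀ n, MeasurableSpace (Ω n)] (f : ∀ n, (ι n → Bool) → Bool)
    (X : ∀ n, ι n → ℝ≥0 → Ω n → Bool) (P : ∀ n, Measure (Ω n)) : Prop :=
  ∀ M : ℕ, Tendsto (fun n => P n {ω | stateChanges (f n) (X n) ω ≤ M}) atTop (𝓝 0)

/-- The majority of three bits. -/
def maj3 (a b c : Bool) : Bool := max (a && b) (max (a && c) (b && c))

/-- The leaves of the rooted ternary tree of depth `n`: a leaf is the sequence of children chosen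
on the way down from the root. -/
abbrev TernaryLeaf (n : ℕ) : Type := Fin n → Fin 3

/-- Iterated 3-majority: the state of the root of the ternary tree of depth `n`, given the states
of the leaves. The state of an inner vertex is the majority of the states of its three children. -/
def iterMaj3 : (n : ℕ) → (TernaryLeaf n → Bool) → Bool
  | 0, y => y Fin.elim0
  | n + 1, y => maj3 (iterMaj3 n fun l => y (Fin.cons 0 l)) (iterMaj3 n fun l => y (Fin.cons 1 l))
      (iterMaj3 n fun l => y (Fin.cons 2 l))

/-! The root states at two times form a pair of bits with equal means, so their law is determined by
mean and covariance, and both satisfy a recursion in the depth (`sum_rootPair`, `rootLaw_eq`). Write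
q_k, v_k, r_k for the mean, variance and correlation at height k, with r_0 = exp(-(t - s)).

Threshold: v_{k+1} = v_k²(3 + 4v_k). The bias 1 - 2q_k starts at 2 n^α (2/3)^n and grows by a factor
of about 3/2 per level while it is small, so for α > 0 it reaches order one about m = α log n /
log(3/2) levels below the root. Above that height v is roughly squared at each level, so v_n is
about exp(-c 2^m) with 2^m = n^(α/α₀). This is smaller than every exponential in n if α > α₀, and
subexponential if α < α₀ (`eventually_bitVar_rootMean_le`, `eventually_le_bitVar_rootMean`).

Lame case: v_k(1 - r_k), the probability of 0 at s and 1 at t, gains a factor of at most 6v_k ≤ 3/2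
per level. A union bound over dyadic grids makes the probability of ever seeing state 1 at most of
order v_n (3/2)^n, which tends to 0.

Volatile case: the odds r/(1 - r) shrink by 4/5 per level, so the root decorrelates over
exponentially short times. Chebyshev's inequality on a fine grid shows both states in each of M + 1
disjoint intervals, provided v_n is not exponentially small at too high a rate
(`measure_stateChanges_le`). -/

/-! ### The law of the root states at two times -/

/-- The joint law on `Bool × Bool` with both marginals of mass `q` at `true` and covariance `c`. -/
def pairWeight (q c : ℝ) (s : Bool × Bool) : ℝ :=
  match s with
  | (true, true) => q ^ 2 + c
  | (true, false) => q * (1 - q) - c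
  | (false, true) => q * (1 - q) - c
  | (false, false) => (1 - q) ^ 2 + c

/-- The probability that the majority of three independent bits is `1`. -/
def majMean (q : ℝ) : ℝ := 3 * q ^ 2 - 2 * q ^ 3

/-- The covariance of the majorities of three independent pairs of bits with mean `q` and
covariance `c`. -/
def majCov (q c : ℝ) : ℝ :=
  12 * (q * (1 - q)) ^ 2 * c + 3 * (1 - 2 * q) ^ 2 * c ^ 2 + 4 * c ^ 3

/-- Coordinatewise majority of three pairs of bits. -/
def majPair (x y z : Bool × Bool) : Bool × Bool := (maj3 x.1 y.1 z.1, maj3 x.2 y.2 z.2)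

/-- Mean and covariance of the root state of a tree of depth `n`. -/
def rootLaw (q c : ℝ) : ℕ → ℝ × ℝ
  | 0 => (q, c)
  | n + 1 => (majMean (rootLaw q c n).1, majCov (rootLaw q c n).1 (rootLaw q c n).2)

/-- The family `pairWeight` is closed under majority, so one level of the tree acts on the two
parameters alone. For each of the four values of `s` this is a polynomial identity. -/
theorem sum_pairWeight_majPair (q c : ℝ) (s : Bool × Bool) :
    (∑ x, ∑ y, ∑ z, if majPair x y z = s then
      pairWeight q c x * pairWeight q c y * pairWeight q c z else 0) =
      pairWeight (majMean q) (majCov q c) s := by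
  rcases s with ⟨_ | _, _ | _⟩ <;>
  · simp [Fintype.sum_prod_type, majPair, maj3, pairWeight, majMean, majCov]
    ring

/-- Coordinatewise root state of a ternary tree. -/
def rootPair (n : ℕ) (z : TernaryLeaf n → Bool × Bool) : Bool × Bool :=
  (iterMaj3 n fun l => (z l).1, iterMaj3 n fun l => (z l).2)

/-- Leaf configurations of a tree are triples of leaf configurations of the subtrees. -/
def leafSplit (n : ℕ) (S : Type*) : (TernaryLeaf (n + 1) → S) ≃
    (TernaryLeaf n → S) × (TernaryLeaf n → S) × (TernaryLeaf n → S) where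
  toFun z := (fun l => z (Fin.cons 0 l), fun l => z (Fin.cons 1 l), fun l => z (Fin.cons 2 l))
  invFun w l := ![w.1 (Fin.tail l), w.2.1 (Fin.tail l), w.2.2 (Fin.tail l)] (l 0)
  left_inv z := by
    ext1 l
    obtain ⟨i, l', rfl⟩ : ∃ i l', l = Fin.cons i l' := ⟨l 0, Fin.tail l, (Fin.cons_self_tail l).symm⟩
    fin_cases i <;> simp [Fin.tail_cons]
  right_inv w := by
    simp [Fin.tail_cons]

theorem prod_ternaryLeaf_succ {n : ℕ} (g : TernaryLeaf (n + 1) → ℝ) :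
    ∏ l, g l = (∏ l, g (Fin.cons 0 l)) * (∏ l, g (Fin.cons 1 l)) * ∏ l, g (Fin.cons 2 l) := by
  rw [← (Fin.consEquiv fun _ : Fin (n + 1) => Fin 3).prod_comp, Fintype.prod_prod_type,
    Fin.prod_univ_three]
  rfl

theorem sum_rootPair (q c : ℝ) (n : ℕ) (s : Bool × Bool) :
    (∑ z : TernaryLeaf n → Bool × Bool, if rootPair n z = s then ∏ l, pairWeight q c (z l) else 0) =
      pairWeight (rootLaw q c n).1 (rootLaw q c n).2 s := by
  induction n generalizing s with
  | zero =>
    rw [← (Equiv.funUnique (TernaryLeaf 0) (Bool × Bool)).symm.sum_comp]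
    simp [rootPair, iterMaj3, rootLaw]
  | succ n ih =>
    rw [rootLaw, ← sum_pairWeight_majPair, ← (leafSplit n (Bool × Bool)).symm.sum_comp,
      Fintype.sum_prod_type]
    conv_lhs => enter [2, x]; rw [Fintype.sum_prod_type]
    simp_rw [← ih]
    have key : ∀ w : (TernaryLeaf n → Bool × Bool) × (TernaryLeaf n → Bool × Bool) ×
        (TernaryLeaf n → Bool × Bool),
        (if rootPair (n + 1) ((leafSplit n (Bool × Bool)).symm w) = s then
          ∏ l, pairWeight q c ((leafSplit n (Bool × Bool)).symm w l) else 0) =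
        if majPair (rootPair n w.1) (rootPair n w.2.1) (rootPair n w.2.2) = s then
          (∏ l, pairWeight q c (w.1 l)) * (∏ l, pairWeight q c (w.2.1 l)) *
            ∏ l, pairWeight q c (w.2.2 l) else 0 := by
      intro w
      rw [prod_ternaryLeaf_succ]
      simp only [leafSplit, rootPair, iterMaj3, majPair, Fin.tail_cons, Equiv.coe_fn_symm_mk,
        Fin.cons_zero, Matrix.cons_val]
      exact if_congr Iff.rfl rfl rfl
    simp_rw [key]
    set W : (TernaryLeaf n → Bool × Bool) → ℝ := fun z => ∏ l, pairWeight q c (z l) with hW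
    -- Configurations of a subtree matter only through its root pair. Grouping by that pair, one
    -- subtree at a time, reduces the sum to the one-level identity.
    have fib : ∀ G : (Bool × Bool) → ℝ, ∑ z, W z * G (rootPair n z) =
        ∑ x, (∑ z, if rootPair n z = x then W z else 0) * G x := by
      intro G
      simp_rw [Finset.sum_mul, ite_mul, zero_mul]
      rw [Finset.sum_comm]
      simp
    calc _ = ∑ a, W a * ∑ b, W b * ∑ d, W d *
          (if majPair (rootPair n a) (rootPair n b) (rootPair n d) = s then 1 else 0) := by
          simp_rw [Finset.mul_sum]
          refine Finset.sum_congr rfl fun a _ => Finset.sum_congr rfl fun b _ =>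
            Finset.sum_congr rfl fun d _ => ?_
          split_ifs <;> simp [hW, mul_assoc]
      _ = _ := by
          rw [fib fun x => ∑ b, W b * ∑ d, W d *
            (if majPair x (rootPair n b) (rootPair n d) = s then 1 else 0)]
          refine Finset.sum_congr rfl fun x _ => ?_
          rw [fib fun y => ∑ d, W d * (if majPair x y (rootPair n d) = s then 1 else 0),
            Finset.mul_sum]
          refine Finset.sum_congr rfl fun y _ => ?_
          rw [fib fun z => if majPair x y z = s then 1 else 0, Finset.mul_sum, Finset.mul_sum]
          refine Finset.sum_congr rfl fun z _ => ?_
          split_ifs <;> simp [hW, mul_assoc]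

/-- The two rates add up to 1, so the generator has eigenvalues 0 and -1. The columns of `U` are
eigenvectors: the constant 1, and (-p, 1 - p). -/
theorem exp_smul_bitGenerator (p : unitInterval) (s : ℝ) :
    NormedSpace.exp (s • bitGenerator p) = 1 + (1 - Real.exp (-s)) • bitGenerator p := by
  set U : Matrix Bool Bool ℝ := Matrix.of fun i j =>
    if j then (if i then 1 - (p : ℝ) else -p) else 1 with hU
  set V : Matrix Bool Bool ℝ := Matrix.of fun i j =>
    if i then (if j then 1 else -1) else (if j then (p : ℝ) else 1 - p) with hV
  have h1 : U * V = 1 := by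
    ext i j
    cases i <;> cases j <;> simp [hU, hV, Matrix.mul_apply]
  have h2 : V * U = 1 := by
    ext i j
    cases i <;> cases j <;> simp [hU, hV, Matrix.mul_apply]
    ring
  have h3 : s • bitGenerator p = U * Matrix.diagonal (fun b : Bool => if b then -s else 0) * V := by
    ext i j
    cases i <;> cases j <;> simp [hU, hV, Matrix.mul_apply, bitGenerator, Matrix.diagonal] <;> ring
  have h4 := Matrix.exp_units_conj (𝔸 := ℝ) ⟨U, V, h1, h2⟩
    (Matrix.diagonal (fun b : Bool => if b then -s else 0))
  simp only [Units.inv_mk] at h4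
  rw [h3, h4, Matrix.exp_diagonal]
  ext i j
  cases i <;> cases j <;>
    simp [hU, hV, Matrix.mul_apply, bitGenerator, Matrix.diagonal, Pi.coe_exp,
      ← Real.exp_eq_exp_ℝ] <;> ring

/-- A single leaf has correlation exp(-(t - s)) between times s and t: the initial value of the
correlation recursion. -/
theorem measure_chain_pair {Ω : Type*} [MeasurableSpace Ω] {p : unitInterval}
    {X : ℝ≥0 → Ω → Bool} {P : Measure Ω} (hX : IsStationaryBitChain p X P) {s t : ℝ≥0} (hst : s ≤ t)
    (b : Bool × Bool) :
    P {ω | (X s ω, X t ω) = b} =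
      ENNReal.ofReal (pairWeight p (p * (1 - p) * Real.exp (-((t : ℝ) - s))) b) := by
  have h := hX.finiteDimLaw 1 ![s, t] ![b.1, b.2] (by
    intro i j hij
    fin_cases i <;> fin_cases j <;> simp_all)
  have e : {ω | ∀ j : Fin (1 + 1), X (![s, t] j) ω = ![b.1, b.2] j} =
      {ω | (X s ω, X t ω) = b} := by
    ext ω
    simp [Fin.forall_fin_two, Prod.ext_iff]
  rw [e] at h
  rw [h, Fin.prod_univ_one, exp_smul_bitGenerator]
  congr 1
  rcases b with ⟨_ | _, _ | _⟩ <;> simp [pairWeight, bitWeight, bitGenerator] <;> ring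

theorem pairWeight_nonneg {q r : ℝ} (hq0 : 0 ≤ q) (hq1 : q ≤ 1) (hr0 : 0 ≤ r) (hr1 : r ≤ 1)
    (b : Bool × Bool) : 0 ≤ pairWeight q (q * (1 - q) * r) b := by
  have h : 0 ≤ q * (1 - q) := mul_nonneg hq0 (by linarith)
  have := mul_nonneg h hr0
  have := mul_nonneg h (sub_nonneg.2 hr1)
  rcases b with ⟨_ | _, _ | _⟩ <;> simp only [pairWeight] <;> nlinarith [sq_nonneg q, sq_nonneg (1 - q)]

theorem measureReal_root_pair {Ω : Type*} [MeasurableSpace Ω] {p : unitInterval} {n : ℕ}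
    {X : TernaryLeaf n → ℝ≥0 → Ω → Bool} {P : Measure Ω} [IsProbabilityMeasure P]
    (hX : IsBitDynamics p X P) {s t : ℝ≥0} (hst : s ≤ t) (b : Bool × Bool) :
    P.real {ω | (iterMaj3 n fun l => X l s ω, iterMaj3 n fun l => X l t ω) = b} =
      pairWeight (rootLaw p (p * (1 - p) * Real.exp (-((t : ℝ) - s))) n).1
        (rootLaw p (p * (1 - p) * Real.exp (-((t : ℝ) - s))) n).2 b := by
  set c : ℝ := p * (1 - p) * Real.exp (-((t : ℝ) - s)) with hc
  rw [← sum_rootPair]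
  set Z : Ω → TernaryLeaf n → Bool × Bool := fun ω l => (X l s ω, X l t ω) with hZ
  have mZ : Measurable Z := measurable_pi_lambda _ fun l =>
    ((hX.chain l).measurable s).prodMk ((hX.chain l).measurable t)
  have hind : iIndepFun (fun l ω => Z ω l) P := by
    have := hX.indep.comp (fun _ (g : ℝ≥0 → Bool) => (g s, g t))
      (fun _ => (measurable_pi_apply s).prodMk (measurable_pi_apply t))
    exact this
  have hpt : ∀ z, P.real (Z ⁻¹' {z}) = ∏ l, pairWeight p c (z l) := by
    intro z
    have h1 : Z ⁻¹' {z} = ⋂ l ∈ Finset.univ, (fun ω => Z ω l) ⁻¹' {z l} := by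
      ext ω
      simp [funext_iff]
    have h0 : (0 : ℝ) ≤ (t : ℝ) - s := sub_nonneg.2 (by exact_mod_cast hst)
    rw [Measure.real, h1, hind.measure_inter_preimage_eq_mul _ fun _ _ => measurableSet_singleton _,
      ENNReal.toReal_prod]
    refine Finset.prod_congr rfl fun l _ => ?_
    have h2 := measure_chain_pair (hX.chain l) hst (z l)
    rw [show (fun ω => Z ω l) ⁻¹' {z l} = {ω | (X l s ω, X l t ω) = z l} from rfl, h2,
      ENNReal.toReal_ofReal (pairWeight_nonneg p.2.1 p.2.2 (Real.exp_pos _).le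
        (Real.exp_le_one_iff.2 (by linarith)) _)]
  have h3 : {ω | (iterMaj3 n fun l => X l s ω, iterMaj3 n fun l => X l t ω) = b} =
      ⋃ z ∈ Finset.univ.filter (fun z => rootPair n z = b), Z ⁻¹' {z} := by
    ext ω
    simp only [Set.mem_ofPred_eq, Set.mem_iUnion, Set.mem_preimage, Set.mem_singleton_iff,
      Finset.mem_filter, Finset.mem_univ, true_and, exists_prop, exists_eq_right']
    rfl
  rw [h3, measureReal_biUnion_finset, Finset.sum_filter]
  · exact Finset.sum_congr rfl fun z _ => by rw [hpt]
  · intro z _ z' _ hzz'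
    exact Disjoint.preimage _ (by simpa using hzz')
  · exact fun z _ => mZ (measurableSet_singleton z)

/-! ### Mean and correlation of the root states -/

/-- The mean of the root state of a tree of depth `n` whose leaves have mean `q`. -/
def rootMean (q : ℝ) : ℕ → ℝ
  | 0 => q
  | n + 1 => majMean (rootMean q n)

/-- The variance of a bit with mean `q`. -/
def bitVar (q : ℝ) : ℝ := q * (1 - q)

/-- The correlation of the majorities of three independent pairs of bits with variance `v` and
correlation `r`. -/
noncomputable def majCorr (v r : ℝ) : ℝ :=
  (12 * v * r + 3 * (1 - 4 * v) * r ^ 2 + 4 * v * r ^ 3) / (3 + 4 * v)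

/-- The correlation of the root states when the pairs at the leaves have mean `q` and
correlation `r`. -/
noncomputable def rootCorr (q r : ℝ) : ℕ → ℝ
  | 0 => r
  | n + 1 => majCorr (bitVar (rootMean q n)) (rootCorr q r n)

/-- The variance recursion. Its factor lies between 3 and 4, so 4v is at most squared and 3v at
least squared by each level. -/
theorem bitVar_majMean (q : ℝ) :
    bitVar (majMean q) = bitVar q ^ 2 * (3 + 4 * bitVar q) := by
  unfold bitVar majMean; ring

theorem bitVar_le (q : ℝ) : bitVar q ≤ 1 / 4 := by
  unfold bitVar; nlinarith [sq_nonneg (q - 1 / 2)]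

theorem rootMean_mem {q : ℝ} (h0 : 0 ≤ q) (h1 : q ≤ 1 / 2) (n : ℕ) :
    0 ≤ rootMean q n ∧ rootMean q n ≤ 1 / 2 := by
  induction n with
  | zero => exact ⟨h0, h1⟩
  | succ n ih =>
    obtain ⟨a, b⟩ := ih
    have h := mul_nonneg (sq_nonneg (rootMean q n)) (by linarith : 0 ≤ 3 - 2 * rootMean q n)
    have h' : 0 ≤ (1 - 2 * rootMean q n) * (1 + 2 * rootMean q n * (1 - rootMean q n)) :=
      mul_nonneg (by linarith) (by nlinarith)
    constructor <;> simp only [rootMean, majMean] <;> nlinarith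

theorem bitVar_rootMean_nonneg {q : ℝ} (h0 : 0 ≤ q) (h1 : q ≤ 1 / 2) (n : ℕ) :
    0 ≤ bitVar (rootMean q n) := by
  obtain ⟨a, b⟩ := rootMean_mem h0 h1 n
  exact mul_nonneg a (by linarith)

theorem rootMean_le_bitVar {q : ℝ} (h0 : 0 ≤ q) (h1 : q ≤ 1 / 2) (n : ℕ) :
    rootMean q n ≤ 2 * bitVar (rootMean q n) := by
  obtain ⟨a, b⟩ := rootMean_mem h0 h1 n
  unfold bitVar
  nlinarith

/-- In `majCorr` the factor v² is already cancelled and the denominator is at least 3, so the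
formula also holds for zero variance. -/
theorem rootLaw_eq {q : ℝ} (h0 : 0 ≤ q) (h1 : q ≤ 1 / 2) (r : ℝ) (n : ℕ) :
    rootLaw q (q * (1 - q) * r) n =
      (rootMean q n, bitVar (rootMean q n) * rootCorr q r n) := by
  induction n with
  | zero => rfl
  | succ n ih =>
    have hv := bitVar_rootMean_nonneg h0 h1 n
    simp only [rootLaw, ih, rootMean, rootCorr, Prod.mk.injEq, true_and]
    rw [bitVar_majMean, majCorr]
    have : 3 + 4 * bitVar (rootMean q n) ≠ 0 := by positivity
    have e : (1 - 2 * rootMean q n) ^ 2 = 1 - 4 * bitVar (rootMean q n) := by unfold bitVar; ring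
    rw [majCov, e]
    field_simp
    unfold bitVar
    ring

/-! ### One level of the correlation recursion -/

section Corr

variable {v r : ℝ}

theorem majCorr_nonneg (hv0 : 0 ≤ v) (hv1 : v ≤ 1 / 4) (hr0 : 0 ≤ r) : 0 ≤ majCorr v r := by
  have : 0 ≤ 1 - 4 * v := by linarith
  unfold majCorr; positivity

theorem one_sub_majCorr (hv0 : 0 ≤ v) :
    1 - majCorr v r =
      (1 - r) * (12 * v + 3 * (1 - 4 * v) * (1 + r) + 4 * v * (1 + r + r ^ 2)) / (3 + 4 * v) := by
  have : 3 + 4 * v ≠ 0 := by positivity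
  unfold majCorr; field_simp; ring

theorem majCorr_le_one (hv0 : 0 ≤ v) (hv1 : v ≤ 1 / 4) (hr0 : 0 ≤ r) (hr1 : r ≤ 1) :
    majCorr v r ≤ 1 := by
  have : 0 ≤ 1 - 4 * v := by linarith
  have : 0 ≤ 1 - r := by linarith
  have h : 0 ≤ 1 - majCorr v r := by rw [one_sub_majCorr hv0]; positivity
  linarith

/-- The odds `r / (1 - r)` of the correlation contract. -/
theorem majCorr_odds (hv0 : 0 ≤ v) (hv1 : v ≤ 1 / 4) (hr0 : 0 ≤ r) (hr1 : r ≤ 1) :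
    (5 / 4) * majCorr v r * (1 - r) ≤ r * (1 - majCorr v r) := by
  -- A bound uniform in v. It gives 1 - `majCorr v r` ≥ (1 - r)(4 + r)/4, and the constant 5/4 comes
  -- from 5(3 + r) ≤ 4(4 + r), sharp at r = 1.
  have h3 : majCorr v r ≤ (3 * r + r ^ 2) / 4 := by
    unfold majCorr
    rw [div_le_div_iff₀ (by positivity) (by norm_num)]
    nlinarith [mul_nonneg (mul_nonneg hr0 (sub_nonneg.2 hr1)) (sub_nonneg.2 hv1),
      mul_nonneg (mul_nonneg (mul_nonneg hr0 hr0) (sub_nonneg.2 hr1)) hv0]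
  nlinarith [mul_nonneg hr0 (sub_nonneg.2 hr1), mul_nonneg (sub_nonneg.2 h3) (sub_nonneg.2 hr1),
    mul_nonneg (sub_nonneg.2 h3) hr0, mul_nonneg (mul_nonneg hr0 (sub_nonneg.2 hr1)) hr0]

/-- The factor 6v is three children times the probability 2v that the other two disagree, so that
the child is pivotal. -/
theorem bitVar_mul_one_sub_majCorr (hv0 : 0 ≤ v) (hv1 : v ≤ 1 / 4) (hr0 : 0 ≤ r) (hr1 : r ≤ 1) :
    v ^ 2 * (3 + 4 * v) * (1 - majCorr v r) ≤ 6 * v * (v * (1 - r)) := by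
  rw [one_sub_majCorr hv0]
  have : 3 + 4 * v ≠ 0 := by positivity
  have h : 12 * v + 3 * (1 - 4 * v) * (1 + r) + 4 * v * (1 + r + r ^ 2) ≤ 6 := by
    nlinarith [mul_nonneg (sub_nonneg.2 hv1) (sub_nonneg.2 hr1),
      mul_nonneg hv0 (mul_nonneg hr0 (sub_nonneg.2 hr1)), mul_nonneg hv0 (sub_nonneg.2 hr1)]
  calc _ = v ^ 2 * (1 - r) *
        (12 * v + 3 * (1 - 4 * v) * (1 + r) + 4 * v * (1 + r + r ^ 2)) := by field_simp
    _ ≤ v ^ 2 * (1 - r) * 6 := by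
        have : 0 ≤ 1 - r := by linarith
        gcongr
    _ = _ := by ring

end Corr

/-! ### Iteration over the levels: correlation, variance and bias -/

section RootCorr

variable {q r : ℝ}

theorem rootCorr_mem (h0 : 0 ≤ q) (h1 : q ≤ 1 / 2) (hr0 : 0 ≤ r) (hr1 : r ≤ 1) (n : ℕ) :
    0 ≤ rootCorr q r n ∧ rootCorr q r n ≤ 1 := by
  induction n with
  | zero => exact ⟨hr0, hr1⟩
  | succ n ih =>
    have hv := bitVar_rootMean_nonneg h0 h1 n
    exact ⟨majCorr_nonneg hv (bitVar_le _) ih.1, majCorr_le_one hv (bitVar_le _) ih.1 ih.2⟩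

theorem rootCorr_one (h0 : 0 ≤ q) (h1 : q ≤ 1 / 2) (n : ℕ) : rootCorr q 1 n = 1 := by
  induction n with
  | zero => rfl
  | succ n ih =>
    have h := one_sub_majCorr (r := 1) (bitVar_rootMean_nonneg h0 h1 n)
    rw [sub_self, zero_mul, zero_div] at h
    rw [rootCorr, ih]
    linarith

theorem rootCorr_odds (h0 : 0 ≤ q) (h1 : q ≤ 1 / 2) (hr0 : 0 ≤ r) (hr1 : r ≤ 1) (n : ℕ) :
    (5 / 4) ^ n * rootCorr q r n * (1 - r) ≤ r * (1 - rootCorr q r n) := by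
  rcases hr1.eq_or_lt with rfl | hr1'
  · simp [rootCorr_one h0 h1]
  -- Strictness is carried through the induction because the step cancels 1 - `rootCorr q r n`.
  have hlt : rootCorr q r n < 1 ∧
      (5 / 4) ^ n * rootCorr q r n * (1 - r) ≤ r * (1 - rootCorr q r n) := by
    induction n with
    | zero => exact ⟨hr1', by simp [rootCorr]⟩
    | succ n ih =>
      have hv := bitVar_rootMean_nonneg h0 h1 n
      obtain ⟨a, b⟩ := rootCorr_mem h0 h1 hr0 hr1 n
      obtain ⟨a', b'⟩ := rootCorr_mem h0 h1 hr0 hr1 (n + 1)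
      have ho := majCorr_odds hv (bitVar_le _) a b
      rw [← rootCorr] at ho
      set x := rootCorr q r n
      set y := rootCorr q r (n + 1)
      have hx : 0 < 1 - x := by linarith [ih.1]
      have hy : y < 1 := by
        refine lt_of_le_of_ne b' fun h => ?_
        rw [h] at ho
        linarith
      refine ⟨hy, ?_⟩
      refine le_of_mul_le_mul_right ?_ hx
      calc (5 / 4) ^ (n + 1) * y * (1 - r) * (1 - x)
          = (5 / 4) ^ n * (1 - r) * ((5 / 4) * y * (1 - x)) := by ring
        _ ≤ (5 / 4) ^ n * (1 - r) * (x * (1 - y)) := by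
            have : 0 ≤ 1 - r := by linarith
            gcongr
        _ = ((5 / 4) ^ n * x * (1 - r)) * (1 - y) := by ring
        _ ≤ (r * (1 - x)) * (1 - y) := by
            have : 0 ≤ 1 - y := by linarith
            exact mul_le_mul_of_nonneg_right ih.2 this
        _ = _ := by ring
  exact hlt.2

/-- Noise sensitivity: exponential decay of the correlation. -/
theorem rootCorr_le (h0 : 0 ≤ q) (h1 : q ≤ 1 / 2) (hr0 : 0 ≤ r) {d : ℝ} (hd : 0 < d)
    (hr1 : r ≤ 1 - d) (n : ℕ) : rootCorr q r n ≤ (4 / 5) ^ n / d := by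
  have h := rootCorr_odds h0 h1 hr0 (by linarith) n
  obtain ⟨a, b⟩ := rootCorr_mem h0 h1 hr0 (by linarith : r ≤ 1) n
  have e : ((4 : ℝ) / 5) ^ n * (5 / 4) ^ n = 1 := by rw [← mul_pow]; norm_num
  rw [le_div_iff₀ hd]
  calc rootCorr q r n * d ≤ rootCorr q r n * (1 - r) := by gcongr; linarith
    _ = (4 / 5) ^ n * ((5 / 4) ^ n * rootCorr q r n * (1 - r)) := by
        linear_combination (-(rootCorr q r n * (1 - r))) * e
    _ ≤ (4 / 5) ^ n * (r * (1 - rootCorr q r n)) := by gcongr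
    _ ≤ (4 / 5) ^ n * (1 * 1) := by gcongr <;> linarith
    _ = _ := by ring

/-- Bound on the probability of a state change of the root. -/
theorem bitVar_mul_one_sub_rootCorr (h0 : 0 ≤ q) (h1 : q ≤ 1 / 2) (hr0 : 0 ≤ r) (hr1 : r ≤ 1)
    (n : ℕ) :
    bitVar (rootMean q n) * (1 - rootCorr q r n) ≤ (3 / 2) ^ n * (1 - r) := by
  induction n with
  | zero =>
    have := bitVar_le q
    have : 0 ≤ 1 - r := by linarith
    simp only [rootMean, rootCorr, pow_zero]
    gcongr
    linarith
  | succ n ih =>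
    have hv := bitVar_rootMean_nonneg h0 h1 n
    obtain ⟨a, b⟩ := rootCorr_mem h0 h1 hr0 hr1 n
    rw [rootMean, rootCorr, bitVar_majMean]
    calc _ ≤ _ := bitVar_mul_one_sub_majCorr hv (bitVar_le _) a b
      _ ≤ 6 * (1 / 4) * (bitVar (rootMean q n) * (1 - rootCorr q r n)) := by
        have : 0 ≤ 1 - rootCorr q r n := by linarith
        have := bitVar_le (rootMean q n)
        gcongr
      _ ≤ 6 * (1 / 4) * ((3 / 2) ^ n * (1 - r)) := by gcongr
      _ = _ := by ring

/-- The last level keeps its factor 6v instead of 3/2; this small variance is what beats (3/2)^n in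
the lame case. -/
theorem bitVar_mul_one_sub_rootCorr_succ (h0 : 0 ≤ q) (h1 : q ≤ 1 / 2) (hr0 : 0 ≤ r) (hr1 : r ≤ 1)
    (n : ℕ) :
    bitVar (rootMean q (n + 1)) * (1 - rootCorr q r (n + 1)) ≤
      6 * bitVar (rootMean q n) * ((3 / 2) ^ n * (1 - r)) := by
  have hv := bitVar_rootMean_nonneg h0 h1 n
  obtain ⟨a, b⟩ := rootCorr_mem h0 h1 hr0 hr1 n
  rw [rootMean, rootCorr, bitVar_majMean]
  exact (bitVar_mul_one_sub_majCorr hv (bitVar_le _) a b).trans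
    (mul_le_mul_of_nonneg_left (bitVar_mul_one_sub_rootCorr h0 h1 hr0 hr1 n) (by positivity))

theorem four_mul_bitVar_majMean_le (q : ℝ) : 4 * bitVar (majMean q) ≤ (4 * bitVar q) ^ 2 := by
  rw [bitVar_majMean]
  nlinarith [mul_nonneg (sq_nonneg (bitVar q)) (sub_nonneg.2 (bitVar_le q))]

theorem four_mul_bitVar_rootMean_add_le (h0 : 0 ≤ q) (h1 : q ≤ 1 / 2) (k m : ℕ) :
    4 * bitVar (rootMean q (k + m)) ≤ (4 * bitVar (rootMean q k)) ^ 2 ^ m := by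
  induction m with
  | zero => simp
  | succ m ih =>
    have hv := bitVar_rootMean_nonneg h0 h1 (k + m)
    calc _ ≤ (4 * bitVar (rootMean q (k + m))) ^ 2 := four_mul_bitVar_majMean_le _
      _ ≤ ((4 * bitVar (rootMean q k)) ^ 2 ^ m) ^ 2 := by gcongr
      _ = _ := by rw [← pow_mul, pow_succ]

theorem le_bitVar_rootMean_add (h0 : 0 ≤ q) (h1 : q ≤ 1 / 2) (k m : ℕ) :
    (3 * bitVar (rootMean q k)) ^ 2 ^ m ≤ 3 * bitVar (rootMean q (k + m)) := by
  induction m with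
  | zero => simp
  | succ m ih =>
    have hv := bitVar_rootMean_nonneg h0 h1 (k + m)
    have hv' := bitVar_rootMean_nonneg h0 h1 k
    calc _ = ((3 * bitVar (rootMean q k)) ^ 2 ^ m) ^ 2 := by rw [← pow_mul, pow_succ]
      _ ≤ (3 * bitVar (rootMean q (k + m))) ^ 2 := by gcongr
      _ ≤ _ := by
        rw [← add_assoc, rootMean, bitVar_majMean]
        nlinarith [pow_nonneg hv 3]

/-- The bias of the root grows at least geometrically, relative to the variance. -/
theorem bias_growth (h0 : 0 ≤ q) (h1 : q ≤ 1 / 2) (n : ℕ) :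
    (3 / 2) ^ n * (1 - 2 * q) * (4 * bitVar (rootMean q n)) ≤ 1 - 2 * rootMean q n := by
  induction n with
  | zero =>
    simp only [rootMean, pow_zero, bitVar]
    nlinarith [mul_nonneg (sub_nonneg.2 h1) (sq_nonneg (1 - 2 * q))]
  | succ n ih =>
    have hv := bitVar_rootMean_nonneg h0 h1 n
    have hv' := bitVar_le (rootMean q n)
    obtain ⟨a, b⟩ := rootMean_mem h0 h1 n
    rw [rootMean, bitVar_majMean]
    have e : 1 - 2 * majMean (rootMean q n) =
        (1 - 2 * rootMean q n) * (1 + 2 * bitVar (rootMean q n)) := by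
      unfold majMean bitVar; ring
    rw [e]
    set v := bitVar (rootMean q n)
    set u := 1 - 2 * rootMean q n
    have hu : 0 ≤ u := by simp only [u]; linarith
    calc (3 / 2) ^ (n + 1) * (1 - 2 * q) * (4 * (v ^ 2 * (3 + 4 * v)))
        = ((3 / 2) ^ n * (1 - 2 * q) * (4 * v)) * ((3 / 2) * v * (3 + 4 * v)) := by ring
      _ ≤ u * ((3 / 2) * v * (3 + 4 * v)) := by gcongr
      -- Equality at v = 1/4. The weight 4v on the left absorbs the loss when the growth factor 1 +
      -- 2v falls below 3/2.
      _ ≤ u * (1 + 2 * v) := by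
        gcongr
        nlinarith [mul_nonneg hv (sub_nonneg.2 hv')]

/-- The bias of the root grows at most geometrically. -/
theorem bias_le (h0 : 0 ≤ q) (h1 : q ≤ 1 / 2) (n : ℕ) :
    1 - 2 * rootMean q n ≤ (3 / 2) ^ n * (1 - 2 * q) := by
  induction n with
  | zero => simp [rootMean]
  | succ n ih =>
    have hv' := bitVar_le (rootMean q n)
    obtain ⟨a, b⟩ := rootMean_mem h0 h1 n
    have e : 1 - 2 * rootMean q (n + 1) =
        (1 - 2 * rootMean q n) * (1 + 2 * bitVar (rootMean q n)) := by
      simp only [rootMean, majMean, bitVar]; ring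
    rw [e]
    calc _ ≤ (1 - 2 * rootMean q n) * (3 / 2) := by
          have : 0 ≤ 1 - 2 * rootMean q n := by linarith
          gcongr
          linarith
      _ ≤ (3 / 2) ^ n * (1 - 2 * q) * (3 / 2) := by gcongr
      _ = _ := by ring

end RootCorr

/-! ### Paths -/

/-- Right-continuity puts a dyadic time with the same value just after each t < 2. The grid runs up
to 2 so that continuity at the endpoint 1 is covered. -/
theorem numChanges_eq_zero_of_dyadic {g : ℝ≥0 → Bool}
    (hg : ∀ t, ContinuousWithinAt g (Set.Ici t) t)
    (h : ∀ L j : ℕ, j ≤ 2 ^ (L + 1) → g ((j : ℝ≥0) / 2 ^ L) = false) : numChanges g 0 1 = 0 := by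
  have h2 : ∀ t < 2, g t = false := by
    intro t ht
    have h1 : ∀ᶠ s in 𝓝[≥] t, g s = g t := by
      have := (hg t).eventually (show ∀ᶠ y in 𝓝 (g t), y = g t by simp [nhds_discrete])
      exact this
    obtain ⟨u, hu, hsub⟩ := (mem_nhdsGE_iff_exists_Ico_subset' ht).1 h1
    obtain ⟨u', hu', hlt⟩ : ∃ u', t < u' ∧ u' ≤ u ∧ u' ≤ 2 :=
      ⟨min u 2, lt_min hu ht, min_le_left _ _, min_le_right _ _⟩
    obtain ⟨L, hL⟩ := exists_pow_lt_of_lt_one (tsub_pos_of_lt hu') (NNReal.half_lt_self one_ne_zero)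
    have hp : (0 : ℝ≥0) < 2 ^ L := by positivity
    set j := ⌊t * 2 ^ L⌋₊ + 1 with hj
    have hjl : t < (j : ℝ≥0) / 2 ^ L := by
      rw [lt_div_iff₀ hp, hj]
      push_cast
      exact Nat.lt_floor_add_one _
    have hju : (j : ℝ≥0) / 2 ^ L < u' := by
      calc (j : ℝ≥0) / 2 ^ L ≤ (t * 2 ^ L + 1) / 2 ^ L := by
            rw [hj]; push_cast; gcongr; exact Nat.floor_le (by positivity)
        _ = t + (1 / 2) ^ L := by rw [add_div, mul_div_cancel_right₀ _ hp.ne', one_div_pow]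
        _ < u' := by
            have := lt_tsub_iff_left.1 hL
            simpa using this
    have hj2 : j ≤ 2 ^ (L + 1) := by
      have := hju.le.trans hlt.2
      rw [div_le_iff₀ hp] at this
      have : (j : ℝ≥0) ≤ ((2 ^ (L + 1) : ℕ) : ℝ≥0) := by
        push_cast; rw [pow_succ']; exact this
      exact_mod_cast this
    have := hsub ⟨hjl.le, hju.trans_le hlt.1⟩
    rw [Set.mem_ofPred_eq, h L j hj2] at this
    exact this.symm
  rw [numChanges, Set.encard_eq_zero, Set.eq_empty_iff_forall_notMem]
  rintro t ⟨⟨-, ht1⟩, ht⟩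
  refine ht ?_
  have : g =ᶠ[𝓝 t] fun _ => false := by
    filter_upwards [Iio_mem_nhds (show t < 2 from lt_of_le_of_lt ht1 (by norm_num))] with s hs
    exact h2 s hs
  exact this.continuousAt

theorem exists_not_continuousAt {g : ℝ≥0 → Bool} {a b s t : ℝ≥0} (hs : s ∈ Set.Ico a b)
    (ht : t ∈ Set.Ico a b) (hst : g s ≠ g t) : ∃ x ∈ Set.Ico a b, ¬ ContinuousAt g x := by
  by_contra! h
  exact hst (isPreconnected_Ico.constant (fun x hx => (h x hx).continuousWithinAt) hs ht)

/-- If the path takes both values in each of `M` consecutive intervals, there are at least `M`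
state changes. -/
theorem le_numChanges {g : ℝ≥0 → Bool} {M : ℕ}
    (h : ∀ i < M, ∃ s ∈ Set.Ico ((i : ℝ≥0) / M) ((i + 1 : ℝ≥0) / M),
      ∃ t ∈ Set.Ico ((i : ℝ≥0) / M) ((i + 1 : ℝ≥0) / M), g s ≠ g t) :
    (M : ℕ∞) ≤ numChanges g 0 1 := by
  have h' : ∀ i : Fin M, ∃ x ∈ Set.Ico ((i : ℝ≥0) / M) ((i + 1 : ℝ≥0) / M), ¬ ContinuousAt g x := by
    intro i
    obtain ⟨s, hs, t, ht, hst⟩ := h i i.2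
    exact exists_not_continuousAt hs ht hst
  choose x hx hc using h'
  have hmono : StrictMono x := by
    intro i j hij
    calc x i < (i + 1 : ℝ≥0) / M := (hx i).2
      _ ≤ (j : ℝ≥0) / M := by
        gcongr
        exact_mod_cast hij
      _ ≤ x j := (hx j).1
  have hle := Set.encard_le_encard_of_injOn (s := Set.univ) (f := x)
    (t := {t ∈ Set.Icc 0 1 | ¬ ContinuousAt g t})
    (fun i _ => ⟨⟨zero_le, (hx i).2.le.trans (by
      have hM : (0 : ℝ≥0) < M := by exact_mod_cast i.pos
      rw [div_le_one hM]
      exact_mod_cast i.2)⟩, hc i⟩) hmono.injective.injOn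
  simpa [numChanges, Set.encard_univ] using hle

/-! ### Second moment bound -/

/-- Chebyshev for the number of events that occur: its mean is Na, its variance at most Na + N²k,
and on the intersection it deviates from the mean by Na. -/
theorem measureReal_iInter_compl_le {Ω : Type*} [MeasurableSpace Ω] {P : Measure Ω}
    [IsProbabilityMeasure P] {N : ℕ} (hN : 0 < N) {A : Fin N → Set Ω}
    (hA : ∀ i, MeasurableSet (A i)) {a k : ℝ} (ha : 0 < a) (hk : 0 ≤ k)
    (h1 : ∀ i, P.real (A i) = a) (h2 : ∀ i j, i < j → P.real (A i ∩ A j) ≤ a ^ 2 + k) :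
    P.real (⋂ i, (A i)ᶜ) ≤ 1 / (N * a) + k / a ^ 2 := by
  have hN' : (0 : ℝ) < N := by exact_mod_cast hN
  set Y : Fin N → Ω → ℝ := fun i => (A i).indicator 1 with hY
  have hYi : ∀ i, Integrable (Y i) P := fun i => (integrable_const 1).indicator (hA i)
  have hYY : ∀ i j ω, Y i ω * Y j ω = (A i ∩ A j).indicator 1 ω := by
    intro i j ω
    rw [Set.inter_indicator_one]; rfl
  have hYYi : ∀ i j, Integrable (fun ω => Y i ω * Y j ω) P := by
    intro i j
    simp_rw [hYY]
    exact (integrable_const 1).indicator ((hA i).inter (hA j))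
  have hint : ∀ i j, Integrable (fun ω => (Y i ω - a) * (Y j ω - a)) P := by
    intro i j
    have : (fun ω => (Y i ω - a) * (Y j ω - a)) =
        fun ω => Y i ω * Y j ω - a * Y i ω - a * Y j ω + a ^ 2 := by ext ω; ring
    rw [this]
    exact (((hYYi i j).sub ((hYi i).const_mul a)).sub ((hYi j).const_mul a)).add
      (integrable_const _)
  have hval : ∀ i j, ∫ ω, (Y i ω - a) * (Y j ω - a) ∂P = P.real (A i ∩ A j) - a ^ 2 := by
    intro i j
    have : (fun ω => (Y i ω - a) * (Y j ω - a)) =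
        fun ω => Y i ω * Y j ω - a * Y i ω - a * Y j ω + a ^ 2 := by ext ω; ring
    have i1 : Integrable (fun ω => Y i ω * Y j ω - a * Y i ω) P :=
      (hYYi i j).sub ((hYi i).const_mul a)
    have i2 : Integrable (fun ω => Y i ω * Y j ω - a * Y i ω - a * Y j ω) P :=
      i1.sub ((hYi j).const_mul a)
    rw [this, integral_add i2 (integrable_const _), integral_sub i1 ((hYi j).const_mul a),
      integral_sub (hYYi i j) ((hYi i).const_mul a)]
    simp_rw [integral_const_mul, hYY]
    rw [integral_indicator_one ((hA i).inter (hA j)), integral_indicator_one (hA i),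
      integral_indicator_one (hA j), h1, h1]
    simp
    ring
  have hbound : ∀ i j, P.real (A i ∩ A j) - a ^ 2 ≤ (if i = j then a else 0) + k := by
    intro i j
    rcases lt_trichotomy i j with h | rfl | h
    · simp only [h.ne, if_false]; linarith [h2 i j h]
    · simp only [Set.inter_self, h1, if_true]; nlinarith
    · rw [Set.inter_comm]
      simp only [h.ne', if_false]; linarith [h2 j i h]
  have hvar : ∫ ω, (∑ i, (Y i ω - a)) ^ 2 ∂P ≤ N * a + N ^ 2 * k := by
    simp_rw [sq (∑ i, (Y i _ - a)), Finset.sum_mul_sum]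
    rw [integral_finsetSum _ fun i _ => integrable_finsetSum _ fun j _ => hint i j]
    simp_rw [integral_finsetSum _ fun j _ => hint _ j, hval]
    refine (Finset.sum_le_sum fun i _ => Finset.sum_le_sum fun j _ => hbound i j).trans ?_
    simp [Finset.sum_add_distrib]
    apply le_of_eq; ring
  have hI : Integrable (fun ω => (∑ i, (Y i ω - a)) ^ 2) P := by
    simp_rw [sq (∑ i, (Y i _ - a)), Finset.sum_mul_sum]
    exact integrable_finsetSum _ fun i _ => integrable_finsetSum _ fun j _ => hint i j
  have hmk := mul_meas_ge_le_integral_of_nonneg (μ := P)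
    (ae_of_all _ fun ω => sq_nonneg (∑ i, (Y i ω - a))) hI ((N * a) ^ 2)
  have hsub : P.real (⋂ i, (A i)ᶜ) ≤ P.real {ω | (N * a) ^ 2 ≤ (∑ i, (Y i ω - a)) ^ 2} := by
    refine measureReal_mono fun ω hω => ?_
    rw [Set.mem_iInter] at hω
    have : ∀ i, Y i ω = 0 := fun i => Set.indicator_of_notMem (hω i) _
    simp [this]
  have hpos : 0 < (N * a) ^ 2 := by positivity
  have : P.real (⋂ i, (A i)ᶜ) ≤ (N * a + N ^ 2 * k) / (N * a) ^ 2 := by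
    rw [le_div_iff₀ hpos, mul_comm]
    exact (mul_le_mul_of_nonneg_left hsub hpos.le).trans (hmk.trans hvar)
  refine this.trans (le_of_eq ?_)
  field_simp

/-! ### The root process -/

section Root

variable {Ω : Type*} [MeasurableSpace Ω] {p : unitInterval} {n : ℕ}
  {X : TernaryLeaf n → ℝ≥0 → Ω → Bool} {P : Measure Ω}

theorem IsBitDynamics.measurable_root (hX : IsBitDynamics p X P) (t : ℝ≥0) :
    Measurable fun ω => iterMaj3 n fun l => X l t ω :=
  (measurable_of_countable (iterMaj3 n)).comp
    (measurable_pi_lambda _ fun l => (hX.chain l).measurable t)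

theorem IsBitDynamics.measurableSet_root (hX : IsBitDynamics p X P) (t : ℝ≥0) (b : Bool) :
    MeasurableSet {ω | iterMaj3 n (fun l => X l t ω) = b} :=
  hX.measurable_root t (measurableSet_singleton b)

theorem IsBitDynamics.rightContinuous_root (hX : IsBitDynamics p X P) :
    ∀ᵐ ω ∂P, ∀ t, ContinuousWithinAt (fun s => iterMaj3 n fun l => X l s ω) (Set.Ici t) t := by
  filter_upwards [ae_all_iff.2 fun l => (hX.chain l).rightContinuous] with ω hω t
  have hc : Continuous (iterMaj3 n) := continuous_of_discreteTopology
  exact hc.continuousAt.comp_continuousWithinAt (continuousWithinAt_pi.2 fun l => hω l t)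

variable [IsProbabilityMeasure P]

theorem IsBitDynamics.measureReal_root_inter (hX : IsBitDynamics p X P) (hp : (p : ℝ) ≤ 1 / 2)
    {s t : ℝ≥0} (hst : s ≤ t) (a b : Bool) :
    P.real ({ω | iterMaj3 n (fun l => X l s ω) = a} ∩ {ω | iterMaj3 n (fun l => X l t ω) = b}) =
      pairWeight (rootMean p n)
        (bitVar (rootMean p n) * rootCorr p (Real.exp (-((t : ℝ) - s))) n) (a, b) := by
  have h := measureReal_root_pair hX hst (a, b)
  rw [rootLaw_eq p.2.1 hp] at h
  rw [← h]
  congr 1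
  ext ω
  simp

theorem IsBitDynamics.measureReal_root (hX : IsBitDynamics p X P) (hp : (p : ℝ) ≤ 1 / 2)
    (t : ℝ≥0) (b : Bool) :
    P.real {ω | iterMaj3 n (fun l => X l t ω) = b} =
      if b then rootMean p n else 1 - rootMean p n := by
  have h := hX.measureReal_root_inter hp (le_refl t) b b
  rw [Set.inter_self, sub_self, neg_zero, Real.exp_zero, rootCorr_one p.2.1 hp] at h
  rw [h]
  cases b <;> simp [pairWeight, bitVar] <;> ring

/-- The probability that the root is in state `1` at some time of a grid. -/
theorem IsBitDynamics.measureReal_exists_grid_le (hX : IsBitDynamics p X P)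
    (hp : (p : ℝ) ≤ 1 / 2) (d : ℝ≥0) (J : ℕ) :
    P.real {ω | ∃ j ≤ J, iterMaj3 n (fun l => X l (j * d) ω) = true} ≤
      rootMean p n + J * (bitVar (rootMean p n) * (1 - rootCorr p (Real.exp (-d)) n)) := by
  induction J with
  | zero =>
    simpa using (hX.measureReal_root hp 0 true).le
  | succ J ih =>
    have hle : ((J : ℝ≥0) * d) ≤ ((J + 1 : ℕ) : ℝ≥0) * d := by gcongr; simp
    have h := hX.measureReal_root_inter hp hle false true
    have e : ((((J + 1 : ℕ) : ℝ≥0) * d : ℝ≥0) : ℝ) - ((J : ℝ≥0) * d : ℝ≥0) = d := by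
      push_cast; ring
    rw [e] at h
    -- A first visit to state 1 at the new grid time is preceded by state 0, so only a 0-to-1 step
    -- has to be paid for.
    have hsub : {ω | ∃ j ≤ J + 1, iterMaj3 n (fun l => X l (j * d) ω) = true} ⊆
        {ω | ∃ j ≤ J, iterMaj3 n (fun l => X l (j * d) ω) = true} ∪
        ({ω | iterMaj3 n (fun l => X l (J * d) ω) = false} ∩
          {ω | iterMaj3 n (fun l => X l ((J + 1 : ℕ) * d) ω) = true}) := by
      rintro ω ⟨j, hj, hjt⟩
      by_cases hex : ∃ j ≤ J, iterMaj3 n (fun l => X l (j * d) ω) = true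
      · exact Or.inl hex
      · refine Or.inr ⟨?_, ?_⟩
        · have := fun h => hex ⟨J, le_rfl, h⟩
          simpa using this
        · have : j = J + 1 := by
            by_contra hne
            exact hex ⟨j, by omega, hjt⟩
          rw [this] at hjt
          exact hjt
    refine (measureReal_mono hsub).trans ((measureReal_union_le _ _).trans ?_)
    rw [h]
    simp only [pairWeight]
    push_cast
    have : rootMean p n * (1 - rootMean p n) = bitVar (rootMean p n) := rfl
    rw [this]
    linarith

end Root

/-- The grid of mesh 2^(-L) has 2^(L+1) steps, each costing at most 6v(3/2)^n 2^(-L), so the bound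
12v(3/2)^n does not depend on L. The grids are nested, and continuity from below reaches all dyadic
times. -/
theorem one_sub_le_measure_stateChanges_eq_zero {Ω : Type*} [MeasurableSpace Ω] {p : unitInterval}
    {n : ℕ} {X : TernaryLeaf (n + 1) → ℝ≥0 → Ω → Bool} {P : Measure Ω} [IsProbabilityMeasure P]
    (hX : IsBitDynamics p X P) (hp : (p : ℝ) ≤ 1 / 2) :
    1 - ENNReal.ofReal (rootMean p (n + 1) + 12 * bitVar (rootMean p n) * (3 / 2) ^ n) ≤
      P {ω | stateChanges (iterMaj3 (n + 1)) X ω = 0} := by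
  set E : ℕ → Set Ω := fun L =>
    {ω | ∃ j : ℕ, j ≤ 2 ^ (L + 1) ∧ iterMaj3 (n + 1) (fun l => X l (j * (1 / 2 ^ L)) ω) = true} with hE
  have hv := bitVar_rootMean_nonneg p.2.1 hp n
  have hEL : ∀ L, P (E L) ≤
      ENNReal.ofReal (rootMean p (n + 1) + 12 * bitVar (rootMean p n) * (3 / 2) ^ n) := by
    intro L
    rw [← ofReal_measureReal]
    apply ENNReal.ofReal_le_ofReal
    have h := hX.measureReal_exists_grid_le hp (1 / 2 ^ L) (2 ^ (L + 1))
    refine h.trans (add_le_add_right ?_ _)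
    have h1 := bitVar_mul_one_sub_rootCorr_succ p.2.1 hp
      (Real.exp_pos (-((1 / 2 ^ L : ℝ≥0) : ℝ))).le (Real.exp_le_one_iff.2 (by simp)) n
    have h2 : 1 - Real.exp (-((1 / 2 ^ L : ℝ≥0) : ℝ)) ≤ 1 / 2 ^ L := by
      have := Real.add_one_le_exp (-((1 / 2 ^ L : ℝ≥0) : ℝ))
      push_cast at this ⊢
      linarith
    calc _ ≤ ((2 ^ (L + 1) : ℕ) : ℝ) *
          (6 * bitVar (rootMean p n) * ((3 / 2) ^ n * (1 / 2 ^ L))) := by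
          refine mul_le_mul_of_nonneg_left (h1.trans ?_) (by positivity)
          gcongr
      _ = _ := by
          push_cast
          rw [pow_succ]
          field_simp
          ring
  have hmono : Monotone E := by
    refine monotone_nat_of_le_succ fun L => ?_
    rintro ω ⟨j, hj, hjt⟩
    refine ⟨2 * j, by rw [pow_succ']; omega, ?_⟩
    have : (((2 * j : ℕ) : ℝ≥0) * (1 / 2 ^ (L + 1))) = j * (1 / 2 ^ L) := by
      push_cast; rw [pow_succ']; field_simp
    rw [this]
    exact hjt
  have hU : P (⋃ L, E L) ≤
      ENNReal.ofReal (rootMean p (n + 1) + 12 * bitVar (rootMean p n) * (3 / 2) ^ n) :=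
    le_of_tendsto' (tendsto_measure_iUnion_atTop hmono) hEL
  have hmeas : MeasurableSet (⋃ L, E L) := by
    refine MeasurableSet.iUnion fun L => ?_
    have : E L = ⋃ j ∈ Finset.range (2 ^ (L + 1) + 1),
        {ω | iterMaj3 (n + 1) (fun l => X l (j * (1 / 2 ^ L)) ω) = true} := by
      ext ω
      simp [hE]
    rw [this]
    exact Finset.measurableSet_biUnion _ fun j _ => hX.measurableSet_root _ _
  calc _ ≤ 1 - P (⋃ L, E L) := tsub_le_tsub_left hU _
    _ = P (⋃ L, E L)ᶜ := (prob_compl_eq_one_sub hmeas).symm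
    _ ≤ _ := by
      refine measure_mono_ae ?_
      filter_upwards [hX.rightContinuous_root] with ω hω hmem
      refine numChanges_eq_zero_of_dyadic hω fun L j hj => ?_
      by_contra hne
      refine hmem (Set.mem_iUnion.2 ⟨L, j, hj, ?_⟩)
      rw [mul_one_div]
      simpa using hne

/-- Split [0,1) into M + 1 slots with N grid times each. With at most M changes, some slot misses
one of the two states at all its grid times; the second moment bound controls these 2(M + 1) events.
-/
theorem measure_stateChanges_le {Ω : Type*} [MeasurableSpace Ω] {p : unitInterval}
    {n : ℕ} {X : TernaryLeaf n → ℝ≥0 → Ω → Bool} {P : Measure Ω} [IsProbabilityMeasure P]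
    (hX : IsBitDynamics p X P) (hp : (p : ℝ) ≤ 1 / 2) (M : ℕ) {N : ℕ} (hN : 0 < N)
    (hv : 0 < bitVar (rootMean p n)) :
    P {ω | stateChanges (iterMaj3 n) X ω ≤ M} ≤
      ENNReal.ofReal (2 * (M + 1) * (1 / (N * bitVar (rootMean p n)) +
        2 * (M + 1) * N * (4 / 5) ^ n / bitVar (rootMean p n))) := by
  set v := bitVar (rootMean p n) with hvdef
  have hN' : (0 : ℝ) < N := by exact_mod_cast hN
  have hNN : (0 : ℝ≥0) < N := by exact_mod_cast hN
  have hMM : (0 : ℝ≥0) < (M : ℝ≥0) + 1 := by positivity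
  set T : ℕ → ℕ → ℝ≥0 := fun i j => (i + j / N) / (M + 1) with hT
  set B : Fin (M + 1) × Bool → Set Ω := fun x =>
    ⋂ j : Fin N, {ω | iterMaj3 n (fun l => X l (T x.1 j) ω) = x.2}ᶜ with hB
  obtain ⟨hm0, hm1⟩ := rootMean_mem p.2.1 hp n
  have hBle : ∀ x, P.real (B x) ≤ 1 / (N * v) + 2 * (M + 1) * N * (4 / 5) ^ n / v := by
    rintro ⟨i, b⟩
    set a : ℝ := if b then rootMean p n else 1 - rootMean p n with ha
    have hav : v ≤ a := by
      rw [ha, hvdef, bitVar]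
      split_ifs <;> nlinarith
    have ha0 : 0 < a := hv.trans_le hav
    set K : ℝ := 2 * (M + 1) * N * (4 / 5) ^ n with hK
    have h := measureReal_iInter_compl_le (P := P) hN
      (A := fun j => {ω | iterMaj3 n (fun l => X l (T i j) ω) = b})
      (fun j => hX.measurableSet_root _ _) ha0 (k := v * K) (by positivity)
      (fun j => hX.measureReal_root hp _ b) (by
        intro j k hjk
        have hjk' : ((j : ℕ) : ℝ≥0) + 1 ≤ (k : ℕ) := by exact_mod_cast hjk
        have hstep : T i j + 1 / ((M + 1) * N) ≤ T i k := by
          have : T i j + 1 / ((M + 1) * N) = (i + (j + 1 : ℝ≥0) / N) / (M + 1) := by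
            simp only [hT]; field_simp; ring
          rw [this]
          simp only [hT]
          gcongr
        have hTle : T i j ≤ T i k := le_self_add.trans hstep
        rw [hX.measureReal_root_inter hp hTle]
        set y : ℝ := 1 / ((M + 1) * N) with hy
        have hy0 : 0 < y := by positivity
        have hstep' : y ≤ (T i k : ℝ) - T i j := by
          have : ((T i j + 1 / ((M + 1) * N) : ℝ≥0) : ℝ) ≤ T i k := by exact_mod_cast hstep
          push_cast at this
          rw [hy]; linarith
        have hy1 : y ≤ 1 := by
          rw [hy, div_le_one (by positivity)]
          have : (1 : ℝ) ≤ N := by exact_mod_cast hN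
          nlinarith [(Nat.cast_nonneg M : (0 : ℝ) ≤ M)]
        -- Distinct grid times are at least y apart, so the leaf correlation stays y/2 below 1;
        -- `rootCorr_le` then bounds the root correlation by (4/5)^n/(y/2) = `K`.
        have hexp : Real.exp (-((T i k : ℝ) - T i j)) ≤ 1 - y / 2 := by
          calc Real.exp (-((T i k : ℝ) - T i j)) ≤ Real.exp (-y) := by gcongr
            _ ≤ 1 / (1 + y) := by
              rw [Real.exp_neg, ← one_div]
              gcongr
              linarith [Real.add_one_le_exp y]
            _ ≤ 1 - y / 2 := by
              rw [div_le_iff₀ (by positivity)]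
              nlinarith
        have hR := rootCorr_le p.2.1 hp (Real.exp_pos (-((T i k : ℝ) - T i j))).le
          (half_pos hy0) hexp n
        have hKe : (4 / 5 : ℝ) ^ n / (y / 2) = K := by
          rw [hy, hK]; field_simp
        rw [hKe] at hR
        have hmul := mul_le_mul_of_nonneg_left hR hv.le
        have hsq : pairWeight (rootMean p n)
            (v * rootCorr p (Real.exp (-((T i k : ℝ) - T i j))) n) (b, b) =
            a ^ 2 + v * rootCorr p (Real.exp (-((T i k : ℝ) - T i j))) n := by
          cases b <;> simp [pairWeight, ha]
        rw [hsq]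
        linarith)
    refine h.trans (add_le_add ?_ ?_)
    · gcongr
    · calc v * K / a ^ 2 ≤ v * K / v ^ 2 := by gcongr
        _ = K / v := by field_simp
  have hsub : {ω | stateChanges (iterMaj3 n) X ω ≤ M} ⊆ ⋃ x, B x := by
    intro ω hω
    by_contra hnot
    have hex : ∀ x : Fin (M + 1) × Bool, ∃ j : Fin N,
        iterMaj3 n (fun l => X l (T x.1 j) ω) = x.2 := by
      intro x
      by_contra! hall
      exact hnot (Set.mem_iUnion.2 ⟨x, Set.mem_iInter.2 hall⟩)
    have hTmem : ∀ (i : ℕ) (j : Fin N),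
        T i j ∈ Set.Ico ((i : ℝ≥0) / (M + 1 : ℕ)) ((i + 1 : ℝ≥0) / (M + 1 : ℕ)) := by
      intro i j
      have : ((j : ℕ) : ℝ≥0) / N < 1 := by
        rw [div_lt_one hNN]; exact_mod_cast j.2
      simp only [hT]
      push_cast
      constructor
      · gcongr; exact le_self_add
      · gcongr
    have hge : ((M + 1 : ℕ) : ℕ∞) ≤ stateChanges (iterMaj3 n) X ω := by
      refine le_numChanges fun i hi => ?_
      obtain ⟨j, hj⟩ := hex (⟨i, hi⟩, true)
      obtain ⟨k, hk⟩ := hex (⟨i, hi⟩, false)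
      exact ⟨_, hTmem i j, _, hTmem i k, by simp only at hj hk ⊢; rw [hj, hk]; simp⟩
    have hcon : ((M + 1 : ℕ) : ℕ∞) ≤ (M : ℕ∞) := hge.trans hω
    have := Nat.cast_le.1 hcon
    omega
  rw [← ofReal_measureReal]
  apply ENNReal.ofReal_le_ofReal
  calc _ ≤ P.real (⋃ x, B x) := measureReal_mono hsub
    _ ≤ ∑ x, P.real (B x) := measureReal_iUnion_fintype_le _
    _ ≤ ∑ _x : Fin (M + 1) × Bool, (1 / (N * v) + 2 * (M + 1) * N * (4 / 5) ^ n / v) :=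
      Finset.sum_le_sum fun x _ => hBle x
    _ = _ := by
      simp only [Finset.sum_const, Finset.card_univ, Fintype.card_prod, Fintype.card_fin,
        Fintype.card_bool, nsmul_eq_mul]
      push_cast
      ring

/-! ### Asymptotics for `p n = 1 / 2 - n ^ α * (2 / 3) ^ n` -/

/-- Converts m levels of bias growth (3/2)^m into the exponent 2^m of repeated squaring; the
critical α₀ is the reciprocal of this power. -/
theorem pow_rpow_log_div_log (m : ℕ) :
    (((3 / 2 : ℝ) ^ m) ^ (Real.log 2 / Real.log (3 / 2))) = 2 ^ m := by
  have hl : 0 < Real.log (3 / 2) := Real.log_pos (by norm_num)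
  have h : ((3 / 2 : ℝ) ^ (Real.log 2 / Real.log (3 / 2))) = 2 := by
    rw [Real.rpow_def_of_pos (by norm_num), mul_div_cancel₀ _ hl.ne', Real.exp_log (by norm_num)]
  rw [← Real.rpow_natCast, ← Real.rpow_mul (by norm_num), mul_comm, Real.rpow_mul (by norm_num), h,
    Real.rpow_natCast]

theorem eventually_bitVar_rootMean_le {α : ℝ} (hα : Real.log (3 / 2) / Real.log 2 < α) :
    ∀ᶠ n : ℕ in atTop, ∀ q : ℝ, 0 ≤ q →
      q = 1 / 2 - ((n + 1 : ℕ) : ℝ) ^ α * (2 / 3 : ℝ) ^ (n + 1) →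
      4 * bitVar (rootMean q n) ≤ (1 / 2) ^ n := by
  have hl : 0 < Real.log (3 / 2) := Real.log_pos (by norm_num)
  have hl2 : 0 < Real.log 2 := Real.log_pos (by norm_num)
  have hα0 : 0 < α := (div_pos hl hl2).trans hα
  set θ : ℝ := Real.log 2 / Real.log (3 / 2) with hθ
  have hθ0 : 0 < θ := div_pos hl2 hl
  have hγ : 1 < α * θ := by
    rw [hθ, mul_div_assoc', one_lt_div hl]
    exact (div_lt_iff₀ hl2).1 hα
  have hcast : Tendsto (fun n : ℕ => ((n + 1 : ℕ) : ℝ)) atTop atTop :=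
    tendsto_natCast_atTop_atTop.comp (tendsto_add_atTop_nat 1)
  have e1 := ((tendsto_rpow_atTop hα0).comp hcast).eventually_ge_atTop (3 / 2)
  have e2 := ((tendsto_rpow_atTop (sub_pos.2 hγ)).comp hcast).eventually_ge_atTop 4
  filter_upwards [e1, e2] with n h1 h2 q hq0 hq
  simp only [Function.comp_apply] at h1 h2
  set x : ℝ := ((n + 1 : ℕ) : ℝ) with hx
  have hx0 : 0 < x := by positivity
  -- The top m levels are for squaring, the lower k = n - m for bias growth. The factor 2/3 accounts
  -- for evaluating at height n with the parameter of depth n + 1.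
  obtain ⟨m, hm, hm'⟩ := exists_nat_pow_near (x := x ^ α * (2 / 3)) (y := 3 / 2) (by linarith)
    (by norm_num)
  have hpow : ((3 : ℝ) / 2) ^ (n + 1) * (2 / 3) ^ (n + 1) = 1 := by rw [← mul_pow]; norm_num
  have hq1 : q ≤ 1 / 2 := by rw [hq]; have : 0 ≤ x ^ α * (2 / 3) ^ (n + 1) := by positivity
                             linarith
  have hε : x ^ α * (2 / 3) ^ (n + 1) ≤ 1 / 2 := by linarith
  have hmn : m ≤ n := by
    have h : ((3 : ℝ) / 2) ^ m ≤ (3 / 2) ^ n := by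
      have h3 : x ^ α ≤ 1 / 2 * (3 / 2) ^ (n + 1) := by
        calc x ^ α = (x ^ α * (2 / 3) ^ (n + 1)) * (3 / 2) ^ (n + 1) := by
              linear_combination (-(x ^ α)) * hpow
          _ ≤ _ := by gcongr
      have h4 : (0 : ℝ) < (3 / 2) ^ n := by positivity
      rw [pow_succ] at h3
      linarith
    exact (pow_le_pow_iff_right₀ (by norm_num)).1 h
  obtain ⟨k, rfl⟩ := Nat.exists_eq_add_of_le' hmn
  have hv := bitVar_rootMean_nonneg hq0 hq1 k
  have hhalf : 4 * bitVar (rootMean q k) ≤ 1 / 2 := by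
    have hb := bias_growth hq0 hq1 k
    have hm0 := (rootMean_mem hq0 hq1 k).1
    -- With `bias_growth` this gives 2 · 4v ≤ 1 - 2q_k ≤ 1.
    have hc : 2 ≤ ((3 : ℝ) / 2) ^ k * (1 - 2 * q) := by
      have : ((3 : ℝ) / 2) ^ k * (1 - 2 * q) * (3 / 2) ^ m = 2 * (x ^ α * (2 / 3)) := by
        have e : ((3 : ℝ) / 2) ^ (k + m + 1) = (3 / 2) ^ k * (3 / 2) ^ m * (3 / 2) := by
          rw [pow_succ, pow_add]
        rw [e] at hpow
        rw [hq]
        linear_combination (4 / 3 * x ^ α) * hpow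
      have hpos : (0 : ℝ) < (3 / 2) ^ m := by positivity
      by_contra! hlt
      nlinarith
    nlinarith
  have hnm : k + m ≤ 2 ^ m := by
    have h : x ^ (α * θ) ≤ 4 * 2 ^ m := by
      have h3 : x ^ α ≤ (3 / 2) ^ (m + 2) := by
        rw [pow_succ (3 / 2 : ℝ) (m + 1)]; linarith
      have h4 := Real.rpow_le_rpow (by positivity) h3 hθ0.le
      rw [pow_rpow_log_div_log, ← Real.rpow_mul hx0.le] at h4
      rw [pow_add] at h4
      linarith
    have h5 : x ^ (α * θ) = x ^ (α * θ - 1) * x := by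
      rw [← Real.rpow_add_one hx0.ne']; ring_nf
    have h6 : x ≤ 2 ^ m := by nlinarith
    have : ((k + m + 1 : ℕ) : ℝ) ≤ ((2 ^ m : ℕ) : ℝ) := by push_cast; rw [hx] at h6; push_cast at h6; exact h6
    have : k + m + 1 ≤ 2 ^ m := by exact_mod_cast this
    omega
  calc _ ≤ _ := four_mul_bitVar_rootMean_add_le hq0 hq1 k m
    _ ≤ (1 / 2) ^ 2 ^ m := by gcongr
    _ ≤ (1 / 2) ^ (k + m) := pow_le_pow_of_le_one (by norm_num) (by norm_num) hnm

theorem eventually_le_bitVar_rootMean {α : ℝ} (hα : α < Real.log (3 / 2) / Real.log 2) :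
    ∀ᶠ n : ℕ in atTop, ∀ q : ℝ, 0 ≤ q → q = 1 / 2 - (n : ℝ) ^ α * (2 / 3 : ℝ) ^ n →
      Real.exp (-(n / 20)) ≤ 3 * bitVar (rootMean q n) := by
  have hl : 0 < Real.log (3 / 2) := Real.log_pos (by norm_num)
  have hl2 : 0 < Real.log 2 := Real.log_pos (by norm_num)
  -- An exponent β between α and the threshold, positive even if α is not, leaves room on both
  -- sides: n^α is negligible against (3/2)^m ≈ n^β, and 2^m is still o(n).
  obtain ⟨β, hβ, hβ1⟩ := exists_between (max_lt hα (div_pos hl hl2))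
  have hβ0 : 0 < β := (le_max_right _ _).trans_lt hβ
  have hαβ : 0 < β - α := sub_pos.2 ((le_max_left _ _).trans_lt hβ)
  set θ : ℝ := Real.log 2 / Real.log (3 / 2) with hθ
  have hθ0 : 0 < θ := div_pos hl2 hl
  have hγ : 0 < 1 - β * θ := by
    rw [sub_pos, hθ, mul_div_assoc', div_lt_one hl]
    exact (lt_div_iff₀ hl2).1 hβ1
  have hcast : Tendsto (fun n : ℕ => (n : ℝ)) atTop atTop := tendsto_natCast_atTop_atTop
  have e1 := ((tendsto_rpow_neg_atTop hαβ).comp hcast).eventually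
    (ge_mem_nhds (show (0 : ℝ) < 1 / 6 by norm_num))
  have e2 := ((tendsto_rpow_neg_atTop hγ).comp hcast).eventually
    (ge_mem_nhds (show (0 : ℝ) < 1 / 20 by norm_num))
  filter_upwards [e1, e2, eventually_ge_atTop 1] with n h1 h2 hn q hq0 hq
  simp only [Function.comp_apply] at h1 h2
  have hx1 : (1 : ℝ) ≤ n := by exact_mod_cast hn
  have hx0 : (0 : ℝ) < n := by linarith
  have hq1 : q ≤ 1 / 2 := by
    have : 0 ≤ (n : ℝ) ^ α * (2 / 3) ^ n := by positivity
    linarith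
  obtain ⟨m, hm, hm'⟩ := exists_nat_pow_near (x := (n : ℝ) ^ β) (y := 3 / 2)
    (Real.one_le_rpow hx1 hβ0.le) (by norm_num)
  have h2m : (2 : ℝ) ^ m ≤ n / 20 := by
    have h4 := Real.rpow_le_rpow (by positivity) hm hθ0.le
    rw [pow_rpow_log_div_log, ← Real.rpow_mul hx0.le] at h4
    have h5 : (n : ℝ) ^ (β * θ) = (n : ℝ) ^ (-(1 - β * θ)) * n := by
      rw [← Real.rpow_add_one hx0.ne']; ring_nf
    rw [h5] at h4
    nlinarith
  have hmn : m ≤ n := by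
    have h3 : (m : ℝ) ≤ 2 ^ m := by exact_mod_cast Nat.lt_two_pow_self.le
    have : (m : ℝ) ≤ n := by linarith
    exact_mod_cast this
  obtain ⟨k, hk⟩ := Nat.exists_eq_add_of_le' hmn
  have hbias : 1 - 2 * rootMean q k ≤ 1 / 2 := by
    refine (bias_le hq0 hq1 k).trans ?_
    have hpow : ((3 : ℝ) / 2) ^ n * (2 / 3) ^ n = 1 := by rw [← mul_pow]; norm_num
    have e : ((3 : ℝ) / 2) ^ n = (3 / 2) ^ k * (3 / 2) ^ m := by rw [hk, pow_add]
    rw [e] at hpow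
    have e3 : ((3 : ℝ) / 2) ^ k * (1 - 2 * q) * (3 / 2) ^ m = 2 * (n : ℝ) ^ α := by
      rw [hq]
      linear_combination (2 * (n : ℝ) ^ α) * hpow
    have e4 : (n : ℝ) ^ α = (n : ℝ) ^ (-(β - α)) * (n : ℝ) ^ β := by
      rw [← Real.rpow_add hx0]; ring_nf
    have hpos : (0 : ℝ) < (3 / 2) ^ m := by positivity
    refine le_of_mul_le_mul_right ?_ hpos
    rw [e3, e4]
    rw [pow_succ] at hm'
    have hb : 0 < (n : ℝ) ^ β := by positivity
    nlinarith
  have hhalf : 1 / 2 ≤ 3 * bitVar (rootMean q k) := by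
    have := (rootMean_mem hq0 hq1 k).2
    unfold bitVar
    nlinarith
  calc Real.exp (-(n / 20)) ≤ Real.exp (-((2 ^ m : ℕ) : ℝ)) := by
        gcongr; push_cast; exact h2m
    _ = Real.exp (-1) ^ 2 ^ m := by rw [← Real.exp_nat_mul, mul_neg_one]
    _ ≤ (1 / 2) ^ 2 ^ m := by
        gcongr
        rw [Real.exp_neg, ← one_div]
        gcongr
        linarith [Real.add_one_le_exp (1 : ℝ)]
    _ ≤ (3 * bitVar (rootMean q k)) ^ 2 ^ m := by gcongr
    _ ≤ 3 * bitVar (rootMean q (k + m)) := le_bitVar_rootMean_add hq0 hq1 k m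
    _ = _ := by rw [hk]

theorem tendsto_ofReal_const_mul_pow {c r : ℝ} (hr0 : 0 ≤ r) (hr1 : r < 1) :
    Tendsto (fun n : ℕ => ENNReal.ofReal (c * r ^ n)) atTop (𝓝 0) := by
  have := ENNReal.tendsto_ofReal ((tendsto_pow_atTop_nhds_zero_of_lt_one hr0 hr1).const_mul c)
  simpa using this

/-! ### The two regimes -/

section IteratedMajority

variable {α : ℝ} {p : ℕ → unitInterval} {Ω : ℕ → Type*} [∀ n, MeasurableSpace (Ω n)]
  {P : ∀ n, Measure (Ω n)} [∀ n, IsProbabilityMeasure (P n)]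
  {X : ∀ n, TernaryLeaf n → ℝ≥0 → Ω n → Bool}

theorem isLame_iterMaj3
    (hp : ∀ᶠ n : ℕ in atTop, (p n : ℝ) = 1 / 2 - (n : ℝ) ^ α * (2 / 3 : ℝ) ^ n)
    (hX : ∀ n, IsBitDynamics (p n) (X n) (P n)) (hα : Real.log (3 / 2) / Real.log 2 < α) :
    IsLame iterMaj3 X P := by
  -- Depth n + 1, because the bound involves the variance one level below the root.
  refine (tendsto_add_atTop_iff_nat 1).1 ?_
  have hlim : Tendsto (fun n : ℕ => 1 - ENNReal.ofReal (4 * (3 / 4) ^ n)) atTop (𝓝 1) := by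
    have := ENNReal.Tendsto.sub (tendsto_const_nhds (x := (1 : ℝ≥0∞)) (f := atTop))
      (tendsto_ofReal_const_mul_pow (c := 4) (r := 3 / 4) (by norm_num) (by norm_num))
      (Or.inl ENNReal.one_ne_top)
    simpa using this
  refine tendsto_of_tendsto_of_tendsto_of_le_of_le' hlim tendsto_const_nhds ?_
    (Eventually.of_forall fun n => prob_le_one)
  filter_upwards [(tendsto_add_atTop_nat 1).eventually hp, eventually_bitVar_rootMean_le hα]
    with n hpn hn
  have h0 : 0 ≤ (p (n + 1) : ℝ) := (p (n + 1)).2.1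
  have h1 : (p (n + 1) : ℝ) ≤ 1 / 2 := by
    have : 0 ≤ ((n + 1 : ℕ) : ℝ) ^ α * (2 / 3) ^ (n + 1) := by positivity
    linarith
  refine le_trans (tsub_le_tsub_left (ENNReal.ofReal_le_ofReal ?_) _)
    (one_sub_le_measure_stateChanges_eq_zero (hX (n + 1)) h1)
  have hb := hn _ h0 hpn
  have hv := bitVar_rootMean_nonneg h0 h1 n
  have hv4 := bitVar_le (rootMean (p (n + 1)) n)
  have hm := rootMean_le_bitVar h0 h1 (n + 1)
  have hs := four_mul_bitVar_majMean_le (rootMean (p (n + 1)) n)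
  rw [← rootMean] at hs
  have hone : (1 : ℝ) ≤ (3 / 2) ^ n := one_le_pow₀ (by norm_num)
  have hm' : rootMean (p (n + 1)) (n + 1) ≤ 2 * bitVar (rootMean (p (n + 1)) n) := by nlinarith
  calc _ ≤ 4 * (4 * bitVar (rootMean (p (n + 1)) n)) * (3 / 2) ^ n := by nlinarith
    _ ≤ 4 * (1 / 2) ^ n * (3 / 2) ^ n := by gcongr
    _ = _ := by rw [mul_assoc, ← mul_pow]; norm_num

theorem isVolatile_iterMaj3
    (hp : ∀ᶠ n : ℕ in atTop, (p n : ℝ) = 1 / 2 - (n : ℝ) ^ α * (2 / 3 : ℝ) ^ n)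
    (hX : ∀ n, IsBitDynamics (p n) (X n) (P n)) (hα : α < Real.log (3 / 2) / Real.log 2) :
    IsVolatile iterMaj3 X P := by
  intro M
  set c : ℝ := 2 * (M + 1) * (3 + 2 * (M + 1) * 2 * 3) with hc
  refine tendsto_of_tendsto_of_tendsto_of_le_of_le' tendsto_const_nhds
    (tendsto_ofReal_const_mul_pow (c := c) (r := Real.exp (-(1 / 20))) (Real.exp_pos _).le
      (Real.exp_lt_one_iff.2 (by norm_num))) (Eventually.of_forall fun n => zero_le) ?_
  filter_upwards [hp, eventually_le_bitVar_rootMean hα] with n hpn hn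
  have h0 : 0 ≤ (p n : ℝ) := (p n).2.1
  have h1 : (p n : ℝ) ≤ 1 / 2 := by
    have : 0 ≤ (n : ℝ) ^ α * (2 / 3) ^ n := by positivity
    linarith
  have hb := hn _ h0 hpn
  set v := bitVar (rootMean (p n) n) with hvdef
  have hv : 0 < v := by linarith [Real.exp_pos (-((n : ℝ) / 20))]
  -- The number of grid times must be large against 1/v and small against (5/4)^n v. Since v ≥
  -- exp(-n/20)/3, growth at rate 10/9 satisfies both.
  have hten : (0 : ℝ) < (10 / 9) ^ n := by positivity
  have hN := Nat.le_ceil (((10 : ℝ) / 9) ^ n)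
  have hN2 : (⌈((10 : ℝ) / 9) ^ n⌉₊ : ℝ) ≤ 2 * (10 / 9) ^ n := by
    have h3 := (Nat.ceil_lt_add_one hten.le).le
    have h4 : (1 : ℝ) ≤ (10 / 9) ^ n := one_le_pow₀ (by norm_num)
    linarith
  set N := ⌈((10 : ℝ) / 9) ^ n⌉₊
  have hNpos : (0 : ℝ) < N := hten.trans_le hN
  refine (measure_stateChanges_le (hX n) h1 M (by exact_mod_cast hNpos) hv).trans
    (ENNReal.ofReal_le_ofReal ?_)
  set E : ℝ := Real.exp (-(1 / 20)) ^ n with hE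
  have hEpos : 0 < E := by positivity
  have hbE : E ≤ 3 * v := by
    refine le_trans (le_of_eq ?_) hb
    rw [hE, ← Real.exp_nat_mul]; congr 1; ring
  have hinv : 1 / v ≤ 3 / E := by
    rw [div_le_div_iff₀ hv hEpos]; linarith
  -- Here E² = exp(-n/10) ≥ (9/10)^n. One factor E pays for 1/v ≤ 3/E, the other tends to 0.
  have hdecay : ∀ r : ℝ, 0 ≤ r → r ≤ 9 / 10 → r ^ n ≤ E * E := by
    intro r hr0 hr
    rw [hE, ← mul_pow, ← Real.exp_add]
    refine pow_le_pow_left₀ hr0 (hr.trans ?_) n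
    have := Real.add_one_le_exp (-(1 / 20) + -(1 / 20) : ℝ)
    linarith
  have t1 : 1 / (N * v) ≤ 3 * E := by
    calc 1 / (N * v) = 1 / N * (1 / v) := by rw [one_div_mul_one_div]
      _ ≤ 1 / (10 / 9) ^ n * (3 / E) := by gcongr
      _ = (9 / 10) ^ n * (3 / E) := by rw [← one_div_pow]; norm_num
      _ ≤ E * E * (3 / E) := by gcongr; exact hdecay _ (by norm_num) le_rfl
      _ = 3 * E := by field_simp
  have t2 : 2 * (M + 1) * N * (4 / 5) ^ n / v ≤ 2 * (M + 1) * 2 * 3 * E := by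
    calc 2 * (M + 1) * N * (4 / 5) ^ n / v = 2 * (M + 1) * N * (4 / 5) ^ n * (1 / v) := by ring
      _ ≤ 2 * (M + 1) * (2 * (10 / 9) ^ n) * (4 / 5) ^ n * (3 / E) := by gcongr
      _ = 2 * (M + 1) * 2 * 3 * (((10 / 9) ^ n * (4 / 5) ^ n) / E) := by ring
      _ ≤ 2 * (M + 1) * 2 * 3 * (E * E / E) := by
        rw [← mul_pow]
        gcongr
        exact hdecay _ (by norm_num) (by norm_num)
      _ = _ := by rw [mul_self_div_self]
  calc _ ≤ 2 * (M + 1) * (3 * E + 2 * (M + 1) * 2 * 3 * E) := by gcongr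
    _ = _ := by rw [hc]; ring

end IteratedMajority

/-- Iterated 3-majority with `p n = 1/2 - n^α (2/3)^n` (for all large `n`, where this is in `[0,1]`)
is lame if `α > log (3/2) / log 2` and volatile if `α < log (3/2) / log 2`. -/
theorem theorem1p4 (α : ℝ) (p : ℕ → unitInterval)
    (hp : ∀ᶠ n : ℕ in atTop, (p n : ℝ) = 1 / 2 - (n : ℝ) ^ α * (2 / 3 : ℝ) ^ n)
    {Ω : ℕ → Type*} [∀ n, MeasurableSpace (Ω n)] (P : ∀ n, Measure (Ω n))
    [∀ n, IsProbabilityMeasure (P n)] (X : ∀ n, TernaryLeaf n → ℝ≥0 → Ω n → Bool)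
    (hX : ∀ n, IsBitDynamics (p n) (X n) (P n)) :
    (Real.log (3 / 2) / Real.log 2 < α → IsLame iterMaj3 X P) ∧
      (α < Real.log (3 / 2) / Real.log 2 → IsVolatile iterMaj3 X P) :=
  ⟨isLame_iterMaj3 hp hX, isVolatile_iterMaj3 hp hX⟩
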